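/- Let $\mathcal R=K[x_1,\dots,x_n]$ over a field $K$ with a monomial order $<$, let $f_1,\dots,f_r\in\mathcal R$, and write $\overline{\alpha}=\sum_i a_if_i$ for $\alpha=\sum_i a_ie_i\in\mathcal R^r$. Order the module monomials of $\mathcal R^r$ position over term: $x^ue_i<x^ve_j$ iff $i<j$, or $i=j$ and $x^u<x^v$. The signature $\mathfrak s(\alpha)$ of $\alpha\ne0$ is its largest module monomial, up to non-zero scalars, and $\mathrm{hd}$ denotes the lead term of a polynomial. Monomials may have any non-zero coefficient. For $\alpha$ with $\overline\alpha\neq0$, a multiple $b\beta$ ($b$ a monomial) is a regular top s-reducer of $\alpha$ if $\mathrm{hd}(\overline{b\beta})=\mathrm{hd}(\overline\alpha)$ and $\mathfrak s(b\beta)<\mathfrak s(\alpha)$; regular s-reduction steps of other terms of $\overline\alpha$ are defined in the same way. For $\overline\alpha,\overline\beta\ne0$ and $\lambda=\mathrm{lcm}(\mathrm{hd}(\overline\alpha),\mathrm{hd}(\overline\beta))$ (monic), the S-pair of $\alpha,\beta$ is $a\alpha-b\beta$ with $a=\lambda/\mathrm{hd}(\overline\alpha)$, $b=\lambda/\mathrm{hd}(\overline\beta)$;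 it is regular if $\mathfrak s(a\alpha)\neq\mathfrak s(b\beta)$, and is then written so that $\mathfrak s(a\alpha)>\mathfrak s(b\beta)$. The algorithm G2V maintains a finite sequence $\mathcal G$ of basis elements, listed in the order in which they were added, a set $\mathcal H$ of known syzygies and a pair set $\mathcal P$. Initially $\mathcal G=\emptyset$, $\mathcal H=\{f_ie_j-f_je_i: i<j\}$ and $\mathcal P=\{e_1,\dots,e_r\}$. An element $\delta\in\mathcal G\cup\mathcal H$ is a rewriter in signature $T$ if $\mathfrak s(d\delta)=T$ for some monomial $d$. The canonical rewriter in $T$ is the one that is largest for $\trianglelefteq_{\mathrm{add}}$, the order in which elements of $\mathcal H$ are on top and an element of $\mathcal G$ is larger the later it was added. A multiple $a\alpha$ with $\alpha\in\mathcal G$ is rewritable if $\alpha$ is not the canonical rewriter in signature $\mathfrak s(a\alpha)$. In each step an entry of $\mathcal P$ of smallest signature $T$ is removed from $\mathcal P$. - The entry may be discarded if the canonical rewriter in $T$ exists and is not the generator of larger signature of any regular S-pair in signature $T$ of elements of $\mathcal G$. It has to be discarded if an element of $\mathcal H$ is a rewriter in $T$. - Otherwise it is regular s-reduced with respect to $\mathcal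 G$ to an element $\delta$ that has no regular top s-reducer from $\mathcal G$. If $\overline\delta=0$, then $\delta$ is added to $\mathcal H$. If $\overline\delta\ne0$, then for each regular S-pair $a\alpha-b\beta$ of $\delta$ and an element of $\mathcal G$ only the generator $a\alpha$ of larger signature is put into $\mathcal P$, only one entry of $\mathcal P$ is kept per signature (any choice of which one is allowed), and $\delta$ is added to $\mathcal G$. At any time regular Koszul syzygies $\overline\beta\alpha-\overline\alpha\beta$ with $\alpha,\beta\in\mathcal G$ and $\mathfrak s(\overline\beta\alpha)\ne\mathfrak s(\overline\alpha\beta)$ may be added to $\mathcal H$. **Statement.** Consider any moment of a run of G2V at which an entry $a\alpha\in\mathcal P$ is next to be handled, that is, $\mathfrak s(a\alpha)$ is smallest in $\mathcal P$. Let $\alpha,\beta\in\mathcal G$ and let $a\alpha-b\beta$ be a regular S-pair with $\mathfrak s(a\alpha)>\mathfrak s(b\beta)$. Suppose that there is another element $\gamma\in\mathcal G$, $\gamma\ne\beta$, and a monomial $c$ such that $c\gamma$ is a regular top s-reducer of $a\alpha$ that is not rewritable at this moment. Then $b\beta$ is rewritable at this moment. -/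

import Mathlib

open MvPolynomial

noncomputable section

namespace G2V

/-- The polynomial ring `K[x₁, …, xₙ]`. -/
abbrev Poly (K : Type*) [Field K] (n : ℕ) : Type _ := MvPolynomial (Fin n) K

/-- The free module `R^r` over `R = K[x₁, …, xₙ]`. -/
abbrev Mod (K : Type*) [Field K] (n r : ℕ) : Type _ := Fin r → Poly K n

variable {K : Type*} [Field K] {n r : ℕ}

/-- The standard basis vector `e_i` of `R^r`. -/
def unitVec (i : Fin r) : Mod K n r := Pi.single i 1

/-- The homomorphism `R^r → R` sending `e_i` to the input polynomial `f_i`. -/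
def proj (f : Fin r → Poly K n) (α : Mod K n r) : Poly K n := ∑ i, α i * f i

/-- A monomial: a polynomial with exactly one term (not necessarily monic). -/
def IsMonomial (a : Poly K n) : Prop := ∃ (d : Fin n →₀ ℕ) (k : K), k ≠ 0 ∧ a = monomial d k

/-- The signature of `α`, up to non-zero scalars: the largest module monomial `x^d e_i` occurring
in `α` for the position-over-term order (first the index `i`, then `d` in the monomial order).
The zero vector has no signature, which is encoded by `⊥`. -/
def sig (m : MonomialOrder (Fin n)) (α : Mod K n r) : WithBot (Fin r ×ₗ m.syn) :=
  Finset.univ.sup fun i => (α i).support.sup fun d =>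
    ((toLex (i, m.toSyn d) : Fin r ×ₗ m.syn) : WithBot (Fin r ×ₗ m.syn))

/-- `b β` is a regular s-reducer of the term of exponent `d` of the polynomial part of `α`. -/
def IsRegularReducerAt (m : MonomialOrder (Fin n)) (f : Fin r → Poly K n)
    (α : Mod K n r) (d : Fin n →₀ ℕ) (b : Poly K n) (β : Mod K n r) : Prop :=
  IsMonomial b ∧ d ∈ (proj f α).support ∧
    m.leadingTerm (proj f (b • β)) = monomial d ((proj f α).coeff d) ∧
    sig m (b • β) < sig m α

/-- `b β` is a regular top s-reducer of `α`: it reduces the lead term of the polynomial part. -/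
def IsRegularTopReducer (m : MonomialOrder (Fin n)) (f : Fin r → Poly K n)
    (α : Mod K n r) (b : Poly K n) (β : Mod K n r) : Prop :=
  IsRegularReducerAt m f α (m.degree (proj f α)) b β

/-- One regular s-reduction step (top or tail) of `α` with respect to the basis `G`. -/
def RegularStep (m : MonomialOrder (Fin n)) (f : Fin r → Poly K n) (G : List (Mod K n r))
    (α α' : Mod K n r) : Prop :=
  ∃ d b, ∃ β ∈ G, IsRegularReducerAt m f α d b β ∧ α' = α - b • β

/-- `γ` is a result of regular s-reducing `α` with respect to `G`. Tail reductions are allowed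
but need not be carried out to the end, so that both full regular s-reduction and regular
top s-reduction are included. -/
def RegularReducesTo (m : MonomialOrder (Fin n)) (f : Fin r → Poly K n) (G : List (Mod K n r))
    (α γ : Mod K n r) : Prop :=
  Relation.ReflTransGen (RegularStep m f G) α γ ∧
    ¬ ∃ b, ∃ β ∈ G, IsRegularTopReducer m f γ b β

/-- `a α - b β` is the S-pair of `α` and `β`, it is regular, and `a α` is its generator of larger
signature. Here `a = λ / hd(α̅)` and `b = λ / hd(β̅)`, lead coefficients included, where `λ` is the
monic least common multiple of the two lead terms. -/
def IsSPair (m : MonomialOrder (Fin n)) (f : Fin r → Poly K n)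
    (a : Poly K n) (α : Mod K n r) (b : Poly K n) (β : Mod K n r) : Prop :=
  proj f α ≠ 0 ∧ proj f β ≠ 0 ∧
    a = monomial ((m.degree (proj f α) ⊔ m.degree (proj f β)) - m.degree (proj f α))
      (m.leadingCoeff (proj f α))⁻¹ ∧
    b = monomial ((m.degree (proj f α) ⊔ m.degree (proj f β)) - m.degree (proj f β))
      (m.leadingCoeff (proj f β))⁻¹ ∧
    sig m (b • β) < sig m (a • α)

/-- The Koszul syzygy of `α` and `β`. -/
def koszul (f : Fin r → Poly K n) (α β : Mod K n r) : Mod K n r :=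
  proj f β • α - proj f α • β

/-- An entry of the pair set: an input generator `e_i`, or one single generator `a α` of an S-pair.
The other generator of the S-pair is not stored. -/
inductive Entry (K : Type*) [Field K] (n r : ℕ) : Type _
  | gen (i : Fin r) : Entry K n r
  | jpair (a : Poly K n) (α : Mod K n r) : Entry K n r

/-- The module element represented by an entry of the pair set. -/
def Entry.val : Entry K n r → Mod K n r
  | .gen i => unitVec i
  | .jpair a α => a • α

/-- A state of the algorithm: the basis `G` (listed in the order in which the elements were added),
the known syzygies `H`, and the pair set `P`. -/
structure State (K : Type*) [Field K] (n r : ℕ) where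
  G : List (Mod K n r)
  H : Set (Mod K n r)
  P : Set (Entry K n r)

/-- `α` was added to the list `G` before `β`. -/
def AddedBefore (G : List (Mod K n r)) (α β : Mod K n r) : Prop :=
  ∃ i j : ℕ, i < j ∧ G[i]? = some α ∧ G[j]? = some β

/-- The rewrite order `⊴_add` on `G ∪ H`: syzygies are on top, and basis elements are compared by
the time at which they were added to `G`. -/
def AddLE (s : State K n r) (α β : Mod K n r) : Prop :=
  β ∈ s.H ∨ α = β ∨ AddedBefore s.G α β

/-- `α ∈ G ∪ H` is a rewriter in signature `T`: some monomial multiple of `α` has signature `T`. -/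
def IsRewriter (m : MonomialOrder (Fin n)) (s : State K n r) (T : WithBot (Fin r ×ₗ m.syn))
    (α : Mod K n r) : Prop :=
  (α ∈ s.G ∨ α ∈ s.H) ∧ ∃ a : Poly K n, IsMonomial a ∧ sig m (a • α) = T

/-- `α` is the canonical, that is `⊴_add`-maximal, rewriter in signature `T`. -/
def IsCanonicalRewriter (m : MonomialOrder (Fin n)) (s : State K n r)
    (T : WithBot (Fin r ×ₗ m.syn)) (α : Mod K n r) : Prop :=
  IsRewriter m s T α ∧ ∀ γ, IsRewriter m s T γ → AddLE s γ α

/-- The multiple `a α` is rewritable: `α` is not the canonical rewriter in its signature. -/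
def Rewritable (m : MonomialOrder (Fin n)) (s : State K n r) (a : Poly K n)
    (α : Mod K n r) : Prop :=
  ¬ IsCanonicalRewriter m s (sig m (a • α)) α

/-- The entry `p` is next to be handled: pairs are handled by increasing signature. -/
def IsNext (m : MonomialOrder (Fin n)) (s : State K n r) (p : Entry K n r) : Prop :=
  p ∈ s.P ∧ ∀ q ∈ s.P, sig m p.val ≤ sig m q.val

/-- The stored generators of the regular S-pairs between a new basis element `γ` and `G`. -/
def newPairs (m : MonomialOrder (Fin n)) (f : Fin r → Poly K n) (G : List (Mod K n r))
    (γ : Mod K n r) : Set (Entry K n r) :=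
  {p | ∃ a α b β, IsSPair m f a α b β ∧ p = .jpair a α ∧
    ((α = γ ∧ β ∈ G) ∨ (α ∈ G ∧ β = γ))}

/-- `P'` keeps, for each signature occurring in `Q`, exactly one entry of `Q`. Which one is kept is
left open, so keeping the most recently generated pair, or the one whose basis element was added
last, are both included. -/
def KeepsOnePerSignature (m : MonomialOrder (Fin n)) (Q P' : Set (Entry K n r)) : Prop :=
  P' ⊆ Q ∧ ∀ p ∈ Q, ∃! q, q ∈ P' ∧ sig m q.val = sig m p.val

/-- The canonical rewriter in signature `T` exists and is not the generator of larger signature of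
any S-pair in signature `T`. In other words, each S-pair in signature `T` has a rewritable first
generator. In particular this holds if a multiple of a known syzygy has signature `T`. -/
def Superfluous (m : MonomialOrder (Fin n)) (f : Fin r → Poly K n) (s : State K n r)
    (T : WithBot (Fin r ×ₗ m.syn)) : Prop :=
  ∃ δ, IsCanonicalRewriter m s T δ ∧
    ∀ a, ∀ α ∈ s.G, ∀ b, ∀ β ∈ s.G, IsSPair m f a α b β → sig m (a • α) = T → α ≠ δ

/-- The initial state: all input generators are pending and the principal syzygies are known. -/
def initial (f : Fin r → Poly K n) : State K n r where
  G := []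
  H := {σ | ∃ i j : Fin r, i < j ∧ σ = f i • unitVec j - f j • unitVec i}
  P := Set.range Entry.gen

/-- One step of the algorithm. An entry of the smallest signature is taken from the pair set.

* It may be discarded if its signature is superfluous.
* If its signature is not that of a multiple of a known syzygy, it may be regular s-reduced.
  If the result is a syzygy, it is added to `H`. Otherwise the S-pairs with the elements of `G` are
  formed, the result is added to `G`, and the pair set stores one single generator of one single
  pair for each signature.

Moreover regular Koszul syzygies of basis elements may be added to `H` (as is done when the
computation for a new index starts). -/
inductive Step (m : MonomialOrder (Fin n)) (f : Fin r → Poly K n) :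
    State K n r → State K n r → Prop
  | discard (s : State K n r) (p : Entry K n r) (hp : IsNext m s p)
      (hT : Superfluous m f s (sig m p.val)) :
      Step m f s { s with P := s.P \ {p} }
  | addSyzygy (s : State K n r) (p : Entry K n r) (γ : Mod K n r) (hp : IsNext m s p)
      (hH : ∀ η ∈ s.H, ¬ IsRewriter m s (sig m p.val) η)
      (hγ : RegularReducesTo m f s.G p.val γ) (h0 : proj f γ = 0) :
      Step m f s { s with H := insert γ s.H, P := s.P \ {p} }
  | addBasis (s : State K n r) (p : Entry K n r) (γ : Mod K n r) (P' : Set (Entry K n r))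
      (hp : IsNext m s p)
      (hH : ∀ η ∈ s.H, ¬ IsRewriter m s (sig m p.val) η)
      (hγ : RegularReducesTo m f s.G p.val γ) (h0 : proj f γ ≠ 0)
      (hP : KeepsOnePerSignature m ((s.P \ {p}) ∪ newPairs m f s.G γ) P') :
      Step m f s { G := s.G ++ [γ], H := s.H, P := P' }
  | addKoszul (s : State K n r) (α β : Mod K n r) (hα : α ∈ s.G) (hβ : β ∈ s.G)
      (hreg : sig m (proj f β • α) ≠ sig m (proj f α • β)) :
      Step m f s { s with H := insert (koszul f α β) s.H }

/-- The states that occur in a run of the algorithm on the input `f`. -/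
def Reachable (m : MonomialOrder (Fin n)) (f : Fin r → Poly K n) (s : State K n r) : Prop :=
  Relation.ReflTransGen (Step m f) (initial f) s

end G2V

end

noncomputable section
namespace G2V
variable {K : Type*} [Field K] {n r : ℕ}

/-! The multiples `b β` and `c γ` both have lead monomial `lcm(hd(α̅), hd(β̅))`, and both signatures
lie below every pending one. If the signatures agree, uniqueness of the canonical rewriter
contradicts `γ ≠ β`. Otherwise the multiple of larger signature is rewritable
(`Invariant.not_isCanonicalRewriter_of_sig_lt`): the two are, up to scalars, a common monomial
multiple of the S-pair of `β` and `γ`, whose signature is too small to be pending. As `c γ` is not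
rewritable, `b β` is.

This rests on `Invariant.spair_handled`: for every regular S-pair of basis elements, its signature
is still pending or its larger generator has been superseded there. Only the signature is recorded,
so it does not matter which pair is kept per signature. Superseding passes to monomial multiples and
persists during the run. -/

/-! ### Signatures under monomial multiplication and subtraction. -/

/-- Multiplication of module monomials by `x^t`. -/
def shift (m : MonomialOrder (Fin n)) (t : Fin n →₀ ℕ) (T : Fin r ×ₗ m.syn) : Fin r ×ₗ m.syn :=
  toLex ((ofLex T).1, m.toSyn t + (ofLex T).2)

theorem shift_strictMono (m : MonomialOrder (Fin n)) (t : Fin n →₀ ℕ) :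
    StrictMono (shift (r := r) m t) := by
  intro x y h
  rw [Prod.Lex.lt_iff] at h ⊢
  simpa [shift] using h

theorem le_shift (m : MonomialOrder (Fin n)) (t : Fin n →₀ ℕ) (T : Fin r ×ₗ m.syn) :
    T ≤ shift m t T := by
  rw [Prod.Lex.le_iff]
  refine Or.inr ⟨rfl, ?_⟩
  simp [shift]

theorem le_map_shift (m : MonomialOrder (Fin n)) (t : Fin n →₀ ℕ)
    (T : WithBot (Fin r ×ₗ m.syn)) : T ≤ T.map (shift m t) := by
  cases T with
  | bot => exact bot_le
  | coe T => exact WithBot.coe_le_coe.mpr (le_shift m t T)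

theorem lt_shift (m : MonomialOrder (Fin n)) {t : Fin n →₀ ℕ} (ht : t ≠ 0)
    (T : Fin r ×ₗ m.syn) : T < shift m t T := by
  rw [Prod.Lex.lt_iff]
  refine Or.inr ⟨rfl, ?_⟩
  simpa [shift] using m.toSyn_lt_iff_ne_zero.mpr ((m.toSyn_eq_zero_iff t).not.mpr ht)

theorem shift_add (m : MonomialOrder (Fin n)) (t u : Fin n →₀ ℕ) (T : Fin r ×ₗ m.syn) :
    shift m (t + u) T = shift m t (shift m u T) := by
  simp [shift, add_assoc]

theorem support_monomial_mul' (t : Fin n →₀ ℕ) {k : K} (hk : k ≠ 0) (p : Poly K n) :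
    (monomial t k * p).support = p.support.map (addLeftEmbedding t) := by
  ext d
  simp only [mem_support_iff, coeff_monomial_mul', Finset.mem_map, addLeftEmbedding_apply]
  constructor
  · intro h
    split_ifs at h with htd
    · exact ⟨d - t, right_ne_zero_of_mul h, add_tsub_cancel_of_le htd⟩
    · exact absurd rfl h
  · rintro ⟨e, he, rfl⟩
    simp [hk, he]

/-- A non-zero term translates supports, and a monotone map commutes with finite suprema. -/
theorem sig_monomial_smul (m : MonomialOrder (Fin n)) (t : Fin n →₀ ℕ) {k : K} (hk : k ≠ 0)
    (α : Mod K n r) : sig m (monomial t k • α) = (sig m α).map (shift m t) := by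
  have hmono : Monotone (WithBot.map (shift (r := r) m t)) :=
    (shift_strictMono m t).monotone.withBot_map
  unfold sig
  rw [Finset.apply_sup_eq_sup_comp_of_linearOrder _ hmono (by rfl)]
  refine Finset.sup_congr rfl fun i _ => ?_
  rw [Function.comp_apply, Finset.apply_sup_eq_sup_comp_of_linearOrder _ hmono (by rfl),
    Pi.smul_apply, smul_eq_mul, support_monomial_mul' t hk, Finset.sup_map]
  refine Finset.sup_congr rfl fun d _ => ?_
  simp [shift]

theorem sig_le_iff (m : MonomialOrder (Fin n)) (α : Mod K n r) (B : WithBot (Fin r ×ₗ m.syn)) :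
    sig m α ≤ B ↔ ∀ i, ∀ d, (α i).coeff d ≠ 0 →
      ((toLex (i, m.toSyn d) : Fin r ×ₗ m.syn) : WithBot (Fin r ×ₗ m.syn)) ≤ B := by
  simp [sig, Finset.sup_le_iff]

theorem sig_eq_bot_iff (m : MonomialOrder (Fin n)) (α : Mod K n r) : sig m α = ⊥ ↔ α = 0 := by
  rw [← le_bot_iff, sig_le_iff]
  constructor
  · intro h
    ext i d
    by_contra hd
    exact absurd (h i d hd) (by simp)
  · rintro rfl
    simp

theorem sig_sub_eq_of_lt (m : MonomialOrder (Fin n)) {α β : Mod K n r}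
    (h : sig m β < sig m α) : sig m (α - β) = sig m α := by
  have le (x : Mod K n r) := (sig_le_iff m x _).mp le_rfl
  apply le_antisymm
  · rw [sig_le_iff]
    intro i d hd
    by_cases hα : (α i).coeff d = 0
    · exact (le β i d (by intro hβ; simp [hα, hβ] at hd)).trans h.le
    · exact le α i d hα
  -- Every monomial of `α` occurs in `α - β` or in `β`, so both cannot have smaller signature.
  · by_contra! hlt
    refine absurd (?_ : sig m α ≤ max (sig m (α - β)) (sig m β)) (not_le.mpr (max_lt hlt h))
    rw [sig_le_iff]
    intro i d hd
    by_cases hβ : (β i).coeff d = 0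
    · exact (le (α - β) i d (by simpa [hβ] using hd)).trans (le_max_left _ _)
    · exact (le β i d hβ).trans (le_max_right _ _)

theorem sig_le_sig_monomial_smul (m : MonomialOrder (Fin n)) (t : Fin n →₀ ℕ) {k : K}
    (hk : k ≠ 0) (α : Mod K n r) : sig m α ≤ sig m (monomial t k • α) := by
  rw [sig_monomial_smul m t hk]
  exact le_map_shift m t _

theorem sig_lt_sig_monomial_smul (m : MonomialOrder (Fin n)) {t : Fin n →₀ ℕ} (ht : t ≠ 0) {k : K}
    (hk : k ≠ 0) {α : Mod K n r} (hα : α ≠ 0) : sig m α < sig m (monomial t k • α) := by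
  rw [sig_monomial_smul m t hk]
  have := mt (sig_eq_bot_iff m α).mp hα
  cases h : sig m α with
  | bot => exact absurd h this
  | coe T => exact WithBot.coe_lt_coe.mpr (lt_shift m ht T)

theorem sig_monomial_add_smul (m : MonomialOrder (Fin n)) (t u : Fin n →₀ ℕ) {k l : K}
    (hk : k ≠ 0) (hl : l ≠ 0) (α : Mod K n r) :
    sig m (monomial (t + u) k • α) = (sig m (monomial u l • α)).map (shift m t) := by
  rw [sig_monomial_smul m _ hk, sig_monomial_smul m _ hl]
  cases sig m α with
  | bot => rfl
  | coe T => exact congrArg _ (shift_add m t u T)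

/-! ### Polynomial parts, regular reduction and S-pairs. -/

theorem proj_smul (f : Fin r → Poly K n) (b : Poly K n) (α : Mod K n r) :
    proj f (b • α) = b * proj f α := by
  simp [proj, Finset.mul_sum, mul_assoc]

theorem proj_sub (f : Fin r → Poly K n) (α β : Mod K n r) :
    proj f (α - β) = proj f α - proj f β := by
  simp [proj, sub_mul]

theorem proj_unitVec (f : Fin r → Poly K n) (i : Fin r) : proj f (unitVec i) = f i := by
  simp [proj, unitVec, Pi.single_apply]

theorem ne_zero_of_proj_ne_zero {f : Fin r → Poly K n} {α : Mod K n r} (h : proj f α ≠ 0) :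
    α ≠ 0 := by
  rintro rfl
  simp [proj] at h

theorem proj_koszul (f : Fin r → Poly K n) (α β : Mod K n r) : proj f (koszul f α β) = 0 := by
  rw [koszul, proj_sub, proj_smul, proj_smul, mul_comm, sub_self]

theorem degree_proj_monomial_smul (m : MonomialOrder (Fin n)) {f : Fin r → Poly K n}
    (t : Fin n →₀ ℕ) {k : K} (hk : k ≠ 0) {α : Mod K n r} (h : proj f α ≠ 0) :
    m.degree (proj f (monomial t k • α)) = t + m.degree (proj f α) := by
  classical
  rw [proj_smul, m.degree_mul (by simpa using hk) h, m.degree_monomial, if_neg hk]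

/-- Each step subtracts a multiple of smaller signature. Hence the result is a rewriter in the
signature of the entry it came from. -/
theorem RegularReducesTo.sig_eq {m : MonomialOrder (Fin n)} {f : Fin r → Poly K n}
    {G : List (Mod K n r)} {α γ : Mod K n r} (h : RegularReducesTo m f G α γ) :
    sig m γ = sig m α := by
  obtain ⟨h, -⟩ := h
  induction h with
  | refl => rfl
  | tail _ hstep ih =>
    obtain ⟨d, b, β, _, hred, rfl⟩ := hstep
    rw [sig_sub_eq_of_lt m hred.2.2.2, ih]

/-- If `lcm` of the lead terms is the lead term of `α̅`, the S-pair yields a regular top reducer. -/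
theorem IsSPair.exists_isRegularTopReducer {m : MonomialOrder (Fin n)} {f : Fin r → Poly K n}
    {a b : Poly K n} {α β : Mod K n r} (h : IsSPair m f a α b β)
    (hle : m.degree (proj f β) ≤ m.degree (proj f α)) :
    ∃ c, IsRegularTopReducer m f α c β := by
  obtain ⟨hα, hβ, rfl, rfl, hlt⟩ := h
  rw [sup_eq_left.mpr hle, tsub_self] at hlt
  have hlα := m.leadingCoeff_ne_zero_iff.mpr hα
  have hlβ := m.leadingCoeff_ne_zero_iff.mpr hβ
  have hk : m.leadingCoeff (proj f α) * (m.leadingCoeff (proj f β))⁻¹ ≠ 0 :=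
    mul_ne_zero hlα (inv_ne_zero hlβ)
  refine ⟨monomial (m.degree (proj f α) - m.degree (proj f β)) _, ⟨_, _, hk, rfl⟩, ?_, ?_, ?_⟩
  · exact m.degree_mem_support hα
  · rw [MonomialOrder.leadingTerm, degree_proj_monomial_smul m _ hk hβ, tsub_add_cancel_of_le hle,
      proj_smul, m.leadingCoeff_mul, m.leadingCoeff_monomial,
      inv_mul_cancel_right₀ hlβ]
    rfl
  · rw [sig_monomial_smul m _ hk]
    rw [sig_monomial_smul m _ (inv_ne_zero hlβ), sig_monomial_smul m _ (inv_ne_zero hlα)] at hlt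
    convert hlt using 1
    cases sig m α with
    | bot => rfl
    | coe T => simp [shift]

/-- The pairs of a regular top s-irreducible element have larger signature than it. -/
theorem sig_lt_of_mem_newPairs {m : MonomialOrder (Fin n)} {f : Fin r → Poly K n}
    {G : List (Mod K n r)} {γ : Mod K n r}
    (hγ : ¬ ∃ b, ∃ β ∈ G, IsRegularTopReducer m f γ b β)
    {p : Entry K n r} (hp : p ∈ newPairs m f G γ) : sig m γ < sig m p.val := by
  obtain ⟨a, α, b, β, h, rfl, ⟨rfl, hβ⟩ | ⟨hα, rfl⟩⟩ := hp
  -- Irreducibility forces the multiplier of the new element to be non-constant, so its signature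
  -- grows strictly.
  · have hnle : ¬ m.degree (proj f β) ≤ m.degree (proj f α) := fun hle =>
      let ⟨c, hc⟩ := h.exists_isRegularTopReducer hle
      hγ ⟨c, β, hβ, hc⟩
    obtain ⟨hα, _, rfl, rfl, _⟩ := h
    refine sig_lt_sig_monomial_smul m ?_ (inv_ne_zero (m.leadingCoeff_ne_zero_iff.mpr hα))
      (ne_zero_of_proj_ne_zero hα)
    rw [Ne, tsub_eq_zero_iff_le]
    exact fun hle => hnle (le_sup_right.trans hle)
  · obtain ⟨hα, hβ, rfl, rfl, hlt⟩ := h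
    exact (sig_le_sig_monomial_smul m _ (inv_ne_zero (m.leadingCoeff_ne_zero_iff.mpr hβ)) _).trans_lt
      hlt

/-! ### Superseded elements and the invariant. -/

/-- Some rewriter in signature `T` is strictly larger than `α` in the rewrite order. -/
def IsSuperseded (m : MonomialOrder (Fin n)) (s : State K n r) (T : WithBot (Fin r ×ₗ m.syn))
    (α : Mod K n r) : Prop :=
  ∃ η, IsRewriter m s T η ∧ (η ∈ s.H ∨ AddedBefore s.G α η)

theorem IsSuperseded.mono {m : MonomialOrder (Fin n)} {s s' : State K n r}
    {T : WithBot (Fin r ×ₗ m.syn)} {α : Mod K n r} (h : IsSuperseded m s T α)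
    (hG : s.G <+: s'.G) (hH : s.H ⊆ s'.H) : IsSuperseded m s' T α := by
  obtain ⟨η, ⟨hη, hT⟩, h⟩ := h
  refine ⟨η, ⟨hη.imp (fun h => hG.subset h) (fun h => hH h), hT⟩, h.imp (fun h => hH h) ?_⟩
  have hget {i : ℕ} {x : Mod K n r} (hi : s.G[i]? = some x) : s'.G[i]? = some x := by
    obtain ⟨L, hL⟩ := hG
    rw [← hL]
    rwa [List.getElem?_append_left (List.getElem?_eq_some_iff.mp hi).1]
  rintro ⟨i, j, hij, hi, hj⟩
  exact ⟨i, j, hij, hget hi, hget hj⟩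

/-- The same `η` works, since the rewrite order does not depend on the signature. -/
theorem IsSuperseded.map_shift {m : MonomialOrder (Fin n)} {s : State K n r}
    {T : WithBot (Fin r ×ₗ m.syn)} {α : Mod K n r} (h : IsSuperseded m s T α)
    (t : Fin n →₀ ℕ) : IsSuperseded m s (T.map (shift m t)) α := by
  obtain ⟨η, ⟨hη, a, ⟨d, k, hk, rfl⟩, rfl⟩, h⟩ := h
  exact ⟨η, ⟨hη, _, ⟨t + d, k, hk, rfl⟩, sig_monomial_add_smul m t d hk hk η⟩, h⟩

/-- The properties of the states of a run that are preserved by every step. -/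
structure Invariant (m : MonomialOrder (Fin n)) (f : Fin r → Poly K n) (s : State K n r) :
    Prop where
  proj_basis : ∀ α ∈ s.G, proj f α ≠ 0
  proj_syzygy : ∀ η ∈ s.H, proj f η = 0
  basis_increasing : s.G.Pairwise fun α β => sig m α < sig m β
  basis_lt_pair : ∀ α ∈ s.G, ∀ p ∈ s.P, sig m α < sig m p.val
  pairs_injOn : Set.InjOn (fun p : Entry K n r => sig m p.val) s.P
  spair_handled : ∀ a, ∀ α ∈ s.G, ∀ b, ∀ β ∈ s.G, IsSPair m f a α b β →
    (∃ p ∈ s.P, sig m p.val = sig m (a • α)) ∨ IsSuperseded m s (sig m (a • α)) α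

theorem Invariant.sig_lt_of_addedBefore {m : MonomialOrder (Fin n)} {f : Fin r → Poly K n}
    {s : State K n r} (hs : Invariant m f s) {α β : Mod K n r} (h : AddedBefore s.G α β) :
    sig m α < sig m β := by
  obtain ⟨i, j, hij, hi, hj⟩ := h
  obtain ⟨hi', rfl⟩ := List.getElem?_eq_some_iff.mp hi
  obtain ⟨hj', rfl⟩ := List.getElem?_eq_some_iff.mp hj
  exact List.pairwise_iff_getElem.mp hs.basis_increasing i j hi' hj' hij

theorem Invariant.not_mem_syzygies {m : MonomialOrder (Fin n)} {f : Fin r → Poly K n}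
    {s : State K n r} (hs : Invariant m f s) {α : Mod K n r} (h : α ∈ s.G) : α ∉ s.H :=
  fun hH => hs.proj_basis α h (hs.proj_syzygy α hH)

theorem AddedBefore.mem_left {G : List (Mod K n r)} {α β : Mod K n r} (h : AddedBefore G α β) :
    α ∈ G :=
  let ⟨_, _, _, hi, _⟩ := h
  List.mem_of_getElem? hi

/-- The rewrite order is antisymmetric here: basis elements are not syzygies, and increasing
signatures rule out repetitions in `G`. -/
theorem Invariant.not_isCanonicalRewriter {m : MonomialOrder (Fin n)} {f : Fin r → Poly K n}
    {s : State K n r} (hs : Invariant m f s) {T : WithBot (Fin r ×ₗ m.syn)} {α : Mod K n r}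
    (hα : α ∈ s.G) (h : IsSuperseded m s T α) : ¬ IsCanonicalRewriter m s T α := by
  obtain ⟨η, hη, h⟩ := h
  intro hcan
  rcases hcan.2 η hη with hH | rfl | hbefore
  · exact hs.not_mem_syzygies hα hH
  · rcases h with h | h
    · exact hs.not_mem_syzygies hα h
    · exact (hs.sig_lt_of_addedBefore h).false
  · rcases h with h | h
    · exact hs.not_mem_syzygies hbefore.mem_left h
    · exact ((hs.sig_lt_of_addedBefore h).trans (hs.sig_lt_of_addedBefore hbefore)).false

theorem Invariant.eq_of_isCanonicalRewriter {m : MonomialOrder (Fin n)} {f : Fin r → Poly K n}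
    {s : State K n r} (hs : Invariant m f s) {T : WithBot (Fin r ×ₗ m.syn)} {α β : Mod K n r}
    (hα : α ∈ s.G) (hβ : β ∈ s.G) (hcα : IsCanonicalRewriter m s T α)
    (hcβ : IsCanonicalRewriter m s T β) : α = β := by
  rcases hcα.2 β hcβ.1 with h | h | h
  · exact absurd h (hs.not_mem_syzygies hα)
  · exact h.symm
  · exact absurd hcβ (hs.not_isCanonicalRewriter hβ ⟨α, hcα.1, Or.inr h⟩)

/-! ### The invariant along a run. -/

theorem invariant_initial (m : MonomialOrder (Fin n)) (f : Fin r → Poly K n) :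
    Invariant m f (initial f) where
  proj_basis := by simp [initial]
  proj_syzygy := by
    rintro _ ⟨i, j, _, rfl⟩
    rw [proj_sub, proj_smul, proj_smul, proj_unitVec, proj_unitVec, mul_comm, sub_self]
  basis_increasing := List.Pairwise.nil
  basis_lt_pair := by simp [initial]
  pairs_injOn := by
    have key (i : Fin r) : sig m (unitVec i : Mod K n r) =
        ((toLex (i, 0) : Fin r ×ₗ m.syn) : WithBot (Fin r ×ₗ m.syn)) := by
      apply le_antisymm
      · rw [sig_le_iff]
        intro j d hd
        rcases eq_or_ne j i with rfl | hij
        · have : d = 0 := by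
            by_contra h
            simp [unitVec, coeff_one, Ne.symm h] at hd
          simp [this]
        · simp [unitVec, hij] at hd
      · have := (sig_le_iff m (unitVec i : Mod K n r) _).mp le_rfl i 0 (by simp [unitVec])
        simpa using this
    rintro _ ⟨i, rfl⟩ _ ⟨j, rfl⟩ h
    simp only [Entry.val, key, WithBot.coe_inj, toLex_inj, Prod.mk.injEq, and_true] at h
    rw [h]
  spair_handled := by simp [initial]

/-- Removing the next entry keeps all S-pairs handled if the elements of `G` that are generators
of larger signature in its signature are superseded. -/
theorem Invariant.handled_of_remove {m : MonomialOrder (Fin n)} {f : Fin r → Poly K n}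
    {s s' : State K n r} (hs : Invariant m f s) {p : Entry K n r}
    (hG : s.G <+: s'.G) (hH : s.H ⊆ s'.H)
    (hP : ∀ q ∈ s.P, q ≠ p → ∃ q' ∈ s'.P, sig m q'.val = sig m q.val)
    {a b : Poly K n} {α β : Mod K n r} (hα : α ∈ s.G) (hβ : β ∈ s.G) (h : IsSPair m f a α b β)
    (hp : sig m p.val = sig m (a • α) → IsSuperseded m s' (sig m (a • α)) α) :
    (∃ q ∈ s'.P, sig m q.val = sig m (a • α)) ∨ IsSuperseded m s' (sig m (a • α)) α := by
  rcases hs.spair_handled a α hα b β hβ h with ⟨q, hq, hqT⟩ | h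
  · by_cases hqp : q = p
    · exact Or.inr (hp (hqp ▸ hqT))
    · obtain ⟨q', hq', hsig⟩ := hP q hq hqp
      exact Or.inl ⟨q', hq', hsig.trans hqT⟩
  · exact Or.inr (h.mono hG hH)

theorem IsSPair.isMonomial_left {m : MonomialOrder (Fin n)} {f : Fin r → Poly K n}
    {a b : Poly K n} {α β : Mod K n r} (h : IsSPair m f a α b β) : IsMonomial a :=
  ⟨_, _, inv_ne_zero (m.leadingCoeff_ne_zero_iff.mpr h.1), h.2.2.1⟩

theorem isRewriter_self {m : MonomialOrder (Fin n)} {s : State K n r} {γ : Mod K n r}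
    (h : γ ∈ s.G ∨ γ ∈ s.H) : IsRewriter m s (sig m γ) γ :=
  ⟨h, 1, ⟨0, 1, one_ne_zero, rfl⟩, by rw [one_smul]⟩

theorem Invariant.step {m : MonomialOrder (Fin n)} {f : Fin r → Poly K n} {s s' : State K n r}
    (hs : Invariant m f s) (h : Step m f s s') : Invariant m f s' := by
  cases h with
  | discard p hp hT =>
    refine ⟨hs.proj_basis, hs.proj_syzygy, hs.basis_increasing,
      fun α hα q hq => hs.basis_lt_pair α hα q hq.1, hs.pairs_injOn.mono Set.sdiff_subset, ?_⟩
    intro a α hα b β hβ h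
    refine hs.handled_of_remove (s' := ⟨s.G, s.H, s.P \ {p}⟩) (p := p)
      (List.prefix_refl _) subset_rfl (fun q hq hne => ⟨q, ⟨hq, hne⟩, rfl⟩)
          hα hβ h fun hsig => ?_
    obtain ⟨δ, hδ, hne⟩ := hT
    -- The generator `α` is itself a rewriter in this signature and differs from `δ`, so `δ`
    -- supersedes it.
    rcases hδ.2 α ⟨Or.inl hα, a, h.isMonomial_left, hsig.symm⟩ with hH | heq | hb
    · exact ⟨δ, hsig ▸ hδ.1, Or.inl hH⟩
    · exact absurd heq (hne a α hα b β hβ h hsig.symm)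
    · exact ⟨δ, hsig ▸ hδ.1, Or.inr hb⟩
  | addSyzygy p γ hp hH hγ h0 =>
    refine ⟨hs.proj_basis, ?_, hs.basis_increasing,
      fun α hα q hq => hs.basis_lt_pair α hα q hq.1, hs.pairs_injOn.mono Set.sdiff_subset, ?_⟩
    · rintro η (rfl | hη)
      exacts [h0, hs.proj_syzygy η hη]
    · intro a α hα b β hβ h
      refine hs.handled_of_remove (s' := ⟨s.G, insert γ s.H, s.P \ {p}⟩) (p := p)
        (List.prefix_refl _) (Set.subset_insert _ _) (fun q hq hne => ⟨q, ⟨hq, hne⟩, rfl⟩)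
          hα hβ h fun hsig => ?_
      rw [← hsig, ← hγ.sig_eq]
      exact ⟨γ, isRewriter_self (Or.inr (Set.mem_insert _ _)), Or.inl (Set.mem_insert _ _)⟩
  | addBasis p γ P' hp hH hγ h0 hP =>
    have hlt : ∀ q ∈ P', sig m γ < sig m q.val := by
      intro q hq
      rcases hP.1 hq with ⟨hq, hne⟩ | hq
      · rw [hγ.sig_eq]
        -- Having one entry per signature makes the minimality of `p` strict.
        exact (hp.2 q hq).lt_of_ne fun h => hne (hs.pairs_injOn hq hp.1 h.symm)
      · exact sig_lt_of_mem_newPairs hγ.2 hq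
    have hlt' : ∀ α ∈ s.G, sig m α < sig m γ := fun α hα => by
      rw [hγ.sig_eq]
      exact hs.basis_lt_pair α hα p hp.1
    have hnew (a b : Poly K n) (α β : Mod K n r) (h : IsSPair m f a α b β)
        (hmem : (α = γ ∧ β ∈ s.G) ∨ (α ∈ s.G ∧ β = γ)) :
        ∃ q ∈ P', sig m q.val = sig m (a • α) :=
      (hP.2 (.jpair a α) (Or.inr ⟨a, α, b, β, h, rfl, hmem⟩)).exists
    refine ⟨?_, hs.proj_syzygy, ?_, ?_, ?_, ?_⟩
    · intro α hα
      rcases List.mem_append.mp hα with hα | hα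
      · exact hs.proj_basis α hα
      · rwa [List.mem_singleton.mp hα]
    · refine List.pairwise_append.mpr ⟨hs.basis_increasing, List.pairwise_singleton _ _, ?_⟩
      intro α hα β hβ
      rw [List.mem_singleton.mp hβ]
      exact hlt' α hα
    · intro α hα q hq
      rcases List.mem_append.mp hα with hα | hα
      · exact (hlt' α hα).trans (hlt q hq)
      · rw [List.mem_singleton.mp hα]
        exact hlt q hq
    · intro p₁ h₁ p₂ h₂ h
      exact (hP.2 p₂ (hP.1 h₂)).unique ⟨h₁, h⟩ ⟨h₂, rfl⟩
    · intro a α hα b β hβ h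
      rcases List.mem_append.mp hα with hα | hα <;> rcases List.mem_append.mp hβ with hβ | hβ
      · refine hs.handled_of_remove (s' := ⟨s.G ++ [γ], s.H, P'⟩) (p := p)
          (List.prefix_append _ _) subset_rfl (fun q hq hne => (hP.2 q (Or.inl ⟨hq, hne⟩)).exists)
          hα hβ h fun hsig => ?_
        rw [← hsig, ← hγ.sig_eq]
        -- The new element has the signature of the removed entry and comes last in the basis, so it
        -- supersedes `α`.
        refine ⟨γ, isRewriter_self (Or.inl (by simp)), Or.inr ?_⟩
        obtain ⟨i, hi, rfl⟩ := List.getElem_of_mem hα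
        exact ⟨i, s.G.length, hi, by rw [List.getElem?_append_left hi, List.getElem?_eq_getElem hi],
          by simp⟩
      · exact Or.inl (hnew a b α β h (Or.inr ⟨hα, List.mem_singleton.mp hβ⟩))
      · exact Or.inl (hnew a b α β h (Or.inl ⟨List.mem_singleton.mp hα, hβ⟩))
      · rw [List.mem_singleton.mp hα, List.mem_singleton.mp hβ] at h
        obtain ⟨_, _, rfl, rfl, hlt⟩ := h
        exact absurd hlt (lt_irrefl _)
  | addKoszul α β hα hβ hreg =>
    refine ⟨hs.proj_basis, ?_, hs.basis_increasing, hs.basis_lt_pair, hs.pairs_injOn, ?_⟩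
    · rintro η (rfl | hη)
      exacts [proj_koszul f α β, hs.proj_syzygy η hη]
    · intro a α' hα' b β' hβ' h
      exact (hs.spair_handled a α' hα' b β' hβ' h).imp_right
        fun h => h.mono (List.prefix_refl _) (Set.subset_insert _ _)

theorem Reachable.invariant {m : MonomialOrder (Fin n)} {f : Fin r → Poly K n} {s : State K n r}
    (hs : Reachable m f s) : Invariant m f s := by
  induction hs with
  | refl => exact invariant_initial m f
  | tail _ h ih => exact ih.step h

/-! ### Comparison of two multiples with the same lead monomial. -/

/-- Below the signatures of all pending pairs, of two multiples of basis elements with the same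
lead monomial the one of larger signature is not a multiple of the canonical rewriter. -/
theorem Invariant.not_isCanonicalRewriter_of_sig_lt {m : MonomialOrder (Fin n)}
    {f : Fin r → Poly K n} {s : State K n r} (hs : Invariant m f s) {t u : Fin n →₀ ℕ} {k l : K}
    (hk : k ≠ 0) (hl : l ≠ 0) {β γ : Mod K n r} (hβ : β ∈ s.G) (hγ : γ ∈ s.G)
    (hdeg : t + m.degree (proj f β) = u + m.degree (proj f γ))
    (hP : ∀ q ∈ s.P, sig m (monomial t k • β) < sig m q.val)
    (hlt : sig m (monomial u l • γ) < sig m (monomial t k • β)) :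
    ¬ IsCanonicalRewriter m s (sig m (monomial t k • β)) β := by
  have hβ0 := hs.proj_basis β hβ
  have hγ0 := hs.proj_basis γ hγ
  have hlβ := inv_ne_zero (m.leadingCoeff_ne_zero_iff.mpr hβ0)
  have hlγ := inv_ne_zero (m.leadingCoeff_ne_zero_iff.mpr hγ0)
  set v := m.degree (proj f β) ⊔ m.degree (proj f γ)
  have hβv : m.degree (proj f β) ≤ v := le_sup_left
  have hγv : m.degree (proj f γ) ≤ v := le_sup_right
  -- The common lead monomial is divisible by the lcm `x^v`; the cofactor `x^w` carries the S-pair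
  -- of `β` and `γ` to the given multiples, up to scalars.
  obtain ⟨w, hw⟩ : ∃ w, t + m.degree (proj f β) = w + v :=
    ⟨_, (tsub_add_cancel_of_le (sup_le le_add_self (hdeg ▸ le_add_self))).symm⟩
  have ht : t = w + (v - m.degree (proj f β)) := by
    apply add_right_cancel (b := m.degree (proj f β))
    rw [hw, add_assoc, tsub_add_cancel_of_le hβv]
  have hu : u = w + (v - m.degree (proj f γ)) := by
    apply add_right_cancel (b := m.degree (proj f γ))
    rw [← hdeg, hw, add_assoc, tsub_add_cancel_of_le hγv]
  have hsβ := sig_monomial_add_smul m w (v - m.degree (proj f β)) hk hlβ β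
  have hsγ := sig_monomial_add_smul m w (v - m.degree (proj f γ)) hl hlγ γ
  rw [← ht] at hsβ
  rw [← hu] at hsγ
  have hpair : IsSPair m f (monomial (v - m.degree (proj f β)) (m.leadingCoeff (proj f β))⁻¹) β
      (monomial (v - m.degree (proj f γ)) (m.leadingCoeff (proj f γ))⁻¹) γ := by
    refine ⟨hβ0, hγ0, rfl, rfl, ?_⟩
    rw [hsβ, hsγ] at hlt
    exact (shift_strictMono m w).withBot_map.lt_iff_lt.mp hlt
  rcases hs.spair_handled _ β hβ _ γ hγ hpair with ⟨q, hq, hqT⟩ | h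
  · refine absurd (hP q hq) (not_lt.mpr ?_)
    rw [hqT, hsβ]
    exact le_map_shift m w _
  · rw [hsβ]
    exact hs.not_isCanonicalRewriter hβ (h.map_shift w)

end G2V
end
theorem mainTheorem12 {K : Type*} [Field K] {n r : ℕ} (m : MonomialOrder (Fin n))
    (f : Fin r → G2V.Poly K n)
    (s : G2V.State K n r) (hs : G2V.Reachable m f s)
    (a b c : G2V.Poly K n) (α β γ : G2V.Mod K n r)
    (hα : α ∈ s.G) (hβ : β ∈ s.G) (hγ : γ ∈ s.G)
    (hpair : G2V.IsSPair m f a α b β)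
    (hnext : G2V.IsNext m s (.jpair a α))
    (hne : γ ≠ β)
    (hred : G2V.IsRegularTopReducer m f (a • α) c γ)
    (hcan : ¬ G2V.Rewritable m s c γ) :
    G2V.Rewritable m s b β := by
  have hinv := hs.invariant
  have hcγ := not_not.mp hcan
  obtain ⟨⟨u, l, hl, rfl⟩, hsupp, hlead, hltγ⟩ := hred
  obtain ⟨hα0, hβ0, rfl, rfl, hltβ⟩ := hpair
  have hγ0 := hinv.proj_basis γ hγ
  have hkα := inv_ne_zero (m.leadingCoeff_ne_zero_iff.mpr hα0)
  have hkβ := inv_ne_zero (m.leadingCoeff_ne_zero_iff.mpr hβ0)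
  have hdeg := congrArg m.degree hlead
  classical
  rw [m.degree_leadingTerm, m.degree_monomial, if_neg (mem_support_iff.mp hsupp),
    G2V.degree_proj_monomial_smul m _ hl hγ0, G2V.degree_proj_monomial_smul m _ hkα hα0,
    tsub_add_cancel_of_le le_sup_left] at hdeg
  -- Both `c γ` and `b β` have the lcm as lead monomial.
  have hdeg' := hdeg.trans (tsub_add_cancel_of_le le_sup_right).symm
  intro hcβ
  rcases lt_trichotomy (G2V.sig m (MvPolynomial.monomial u l • γ))
    (G2V.sig m (MvPolynomial.monomial (m.degree (G2V.proj f α) ⊔ m.degree (G2V.proj f β) -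
      m.degree (G2V.proj f β)) (m.leadingCoeff (G2V.proj f β))⁻¹ • β)) with h | h | h
  · exact hinv.not_isCanonicalRewriter_of_sig_lt hkβ hl hβ hγ hdeg'.symm
      (fun q hq => hltβ.trans_le (hnext.2 q hq)) h hcβ
  · exact hne (hinv.eq_of_isCanonicalRewriter hγ hβ hcγ (h ▸ hcβ))
  · exact hinv.not_isCanonicalRewriter_of_sig_lt hl hkβ hγ hβ hdeg'
      (fun q hq => hltγ.trans_le (hnext.2 q hq)) h hcγ
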